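/- Let $M$ be an $m$-dimensional differentiable (smooth) manifold and let $\mathbf{T}M=TM\oplus T^*M$ be its big tangent bundle, with the neutral metric $g((X,\alpha),(Y,\mu))=\alpha(Y)+\mu(X)$ and the Courant bracket $$[(X,\alpha),(Y,\mu)]=\Big([X,Y],\;L_X\mu-L_Y\alpha+\tfrac12 d(\alpha(Y)-\mu(X))\Big).$$ Let $G$ be a generalized Riemannian metric on $M$, i.e. $G(\mathcal X,\mathcal Y)=g(\phi\mathcal X,\mathcal Y)$ for a smooth bundle endomorphism $\phi$ of $\mathbf{T}M$ with $\phi^2=\mathrm{Id}$, $g(\phi\mathcal X,\phi\mathcal Y)=g(\mathcal X,\mathcal Y)$ and $G$ positive definite. Let $E\subset\mathbf{T}M$ be an almost Dirac structure, i.e. a smooth subbundle whose fibres are maximal $g$-isotropic; $E$ is called integrable if $\Gamma E$ is closed under the Courant bracket. Let $\Psi_E$ be the endomorphism of $\mathbf{T}M$ that equals $\mathrm{Id}$ on $E$ and $-\mathrm{Id}$ on the $G$-orthogonal complement $E^{\perp_G}$. A big connection is a smooth connection $\nabla$ on the vector bundle $\mathbf{T}M$ with $X(g(\mathcal Y,\mathcal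 Z))=g(\nabla_X\mathcal Y,\mathcal Z)+g(\mathcal Y,\nabla_X\mathcal Z)$; it preserves $E$ if $\nabla_X\mathcal Y\in\Gamma E$ for all vector fields $X$ and all $\mathcal Y\in\Gamma E$. For $\mathcal X=(X,\alpha)$ and $\mathcal Y=(Y,\mu)$ in $\Gamma\mathbf{T}M$ put $\nabla_{\mathcal X}=\nabla_X$ and $T^\nabla(\mathcal X,\mathcal Y)=\nabla_X\mathcal Y-\nabla_Y\mathcal X-[\mathcal X,\mathcal Y]$. The Gualtieri torsion of $\nabla$ is $$\mathcal T^\nabla(\mathcal X,\mathcal Y,\mathcal Z)=g(T^\nabla(\mathcal X,\mathcal Y),\mathcal Z)+\tfrac12\big[g(\nabla_{\mathcal Z}\mathcal X,\mathcal Y)-g(\nabla_{\mathcal Z}\mathcal Y,\mathcal X)\big].$$ Consider the condition $$\mathcal T^\nabla(\mathcal X,\mathcal Y,\mathcal Z)+\mathcal T^\nabla(\mathcal X,\Psi_E\mathcal Y,\mathcal Z)+\mathcal T^\nabla(\Psi_E\mathcal X,\mathcal Y,\mathcal Z)+\mathcal T^\nabla(\Psi_E\mathcal X,\Psi_E\mathcal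 Y,\mathcal Z)=0\qquad\forall\,\mathcal X,\mathcal Y\in\Gamma\mathbf{T}M,\ \mathcal Z\in\Gamma E.\tag{$*$}$$ If there exists a big connection $\nabla$ that preserves $E$ and satisfies $(*)$, then $E$ is integrable. Conversely, if $E$ is integrable, then $(*)$ holds for every big connection $\nabla$ that preserves $E$. -/

import Mathlib

open Bundle
open scoped Manifold ContDiff Bundle

noncomputable section

namespace GeneralizedGeometry

/-! ### The big tangent bundle -/

/-- The model fibre `ℝᵐ ⊕ (ℝᵐ)*` of the big tangent bundle. -/
abbrev BigModel (m : ℕ) : Type :=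
  EuclideanSpace ℝ (Fin m) × (EuclideanSpace ℝ (Fin m) →L[ℝ] ℝ)

/-- The cotangent bundle `T*M`, as the bundle of linear maps from `TM` to the trivial line bundle. -/
abbrev Cotangent (m : ℕ) (M : Type*) [TopologicalSpace M]
    [ChartedSpace (EuclideanSpace ℝ (Fin m)) M] : M → Type :=
  fun x => TangentSpace (𝓡 m) x →L[ℝ] Trivial M ℝ x

/-- The big tangent bundle `TM ⊕ T*M`. -/
abbrev BigTangent (m : ℕ) (M : Type*) [TopologicalSpace M]
    [ChartedSpace (EuclideanSpace ℝ (Fin m)) M] : M → Type :=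
  (fun x : M => TangentSpace (𝓡 m) x) ×ᵇ Cotangent m M

variable {m : ℕ} {M : Type*} [TopologicalSpace M] [ChartedSpace (EuclideanSpace ℝ (Fin m)) M]

/-- The neutral metric `g((X, α), (Y, μ)) = α(Y) + μ(X)` on a fibre of the big tangent bundle,
as a bilinear form. -/
def neutral (x : M) : LinearMap.BilinForm ℝ (BigTangent m M x) :=
  LinearMap.mk₂ ℝ (fun u v => (u.2 v.1 + v.2 u.1 : ℝ))
    (fun u u' v => by simp; ring) (fun c u v => by simp; ring)
    (fun u v v' => by simp; ring) (fun c u v => by simp; ring)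

/-- The total space of the big tangent bundle. -/
abbrev BigTangentTotal (m : ℕ) (M : Type*) [TopologicalSpace M]
    [ChartedSpace (EuclideanSpace ℝ (Fin m)) M] : Type _ :=
  TotalSpace (BigModel m) (BigTangent m M)

section Smooth

variable [IsManifold (𝓡 m) ∞ M]

/-- Smoothness on a set `U` of a (set-theoretic) section of the big tangent bundle. -/
def SmoothSectionOn (U : Set M) (s : Π x : M, BigTangent m M x) : Prop :=
  ContMDiffOn (𝓡 m) ((𝓡 m).prod 𝓘(ℝ, BigModel m)) ∞
    (fun x => (⟨x, s x⟩ : BigTangentTotal m M)) U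

/-- Global smooth sections of the big tangent bundle. -/
def SmoothSection (s : Π x : M, BigTangent m M x) : Prop :=
  ContMDiff (𝓡 m) ((𝓡 m).prod 𝓘(ℝ, BigModel m)) ∞
    (fun x => (⟨x, s x⟩ : BigTangentTotal m M))

end Smooth

/-! ### The Courant bracket -/

/-- The exterior derivative of a 1-form `μ` at `x`, computed in the preferred chart at `x`:
`dμ(u, v) = (∂_u μ)(v) - (∂_v μ)(u)`, where `μ` is read as a function with values in `(ℝᵐ)*`
through the coordinate frame of that chart. (The coordinate frame of the preferred chart at `x`
identifies `T_x M` with `ℝᵐ` by the identity map.) -/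
def extDer (μ : Π x : M, Cotangent m M x) [IsManifold (𝓡 m) 1 M] (x : M) :
    TangentSpace (𝓡 m) x →L[ℝ] TangentSpace (𝓡 m) x →L[ℝ] ℝ :=
  let D : EuclideanSpace ℝ (Fin m) →L[ℝ] EuclideanSpace ℝ (Fin m) →L[ℝ] ℝ :=
    mvfderiv (𝓡 m) (fun y : M => ContinuousLinearMap.inCoordinates
      (EuclideanSpace ℝ (Fin m)) (fun y : M => TangentSpace (𝓡 m) y) ℝ (Trivial M ℝ)
      x y x y (μ y)) x
  D - D.flip

/-- The Lie derivative of a 1-form along a vector field, `L_X μ = i(X) dμ + d(μ(X))`. -/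
def lieDerForm [IsManifold (𝓡 m) 1 M] (X : Π x : M, TangentSpace (𝓡 m) x)
    (μ : Π x : M, Cotangent m M x) (x : M) : TangentSpace (𝓡 m) x →L[ℝ] ℝ :=
  extDer μ x (X x) + mvfderiv (𝓡 m) (fun y : M => (μ y (X y) : ℝ)) x

/-- The Courant bracket
`[(X, α), (Y, μ)] = ([X, Y], L_X μ - L_Y α + ½ d(α(Y) - μ(X)))`. -/
def courant [IsManifold (𝓡 m) 1 M] (s t : Π x : M, BigTangent m M x) (x : M) :
    BigTangent m M x :=
  (VectorField.mlieBracket (𝓡 m) (fun y => (s y).1) (fun y => (t y).1) x,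
    lieDerForm (fun y => (s y).1) (fun y => (t y).2) x
      - lieDerForm (fun y => (t y).1) (fun y => (s y).2) x
      + (1 / 2 : ℝ) • mvfderiv (𝓡 m)
          (fun y : M => ((s y).2 (t y).1 - (t y).2 (s y).1 : ℝ)) x)

variable [IsManifold (𝓡 m) ∞ M]

/-! ### Generalized Riemannian metrics -/

variable (m M) in
/-- A generalized Riemannian metric, given by a smooth endomorphism `φ` of the big tangent bundle
with `φ² = Id`, `g(φ u, φ v) = g(u, v)` and such that `G(u, v) = g(φ u, v)` is positive definite. -/
structure GenRiemannianMetric where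
  phi : Π x : M, BigTangent m M x →ₗ[ℝ] BigTangent m M x
  smooth : ContMDiff ((𝓡 m).prod 𝓘(ℝ, BigModel m)) ((𝓡 m).prod 𝓘(ℝ, BigModel m)) ∞
    (fun p : BigTangentTotal m M => (⟨p.1, phi p.1 p.2⟩ : BigTangentTotal m M))
  phi_phi : ∀ x u, phi x (phi x u) = u
  isometry : ∀ x u v, neutral x (phi x u) (phi x v) = neutral x u v
  posDef : ∀ x u, u ≠ 0 → 0 < neutral x (phi x u) u

/-- The metric `G(u, v) = g(φ u, v)` on a fibre. -/
def GenRiemannianMetric.form (G : GenRiemannianMetric m M) (x : M) :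
    LinearMap.BilinForm ℝ (BigTangent m M x) :=
  (neutral x).comp (G.phi x) LinearMap.id

/-! ### Almost Dirac structures -/

/-- A subspace of a fibre of the big tangent bundle is `g`-isotropic if `g` vanishes on it. -/
def IsIsotropic (x : M) (W : Submodule ℝ (BigTangent m M x)) : Prop :=
  ∀ u ∈ W, ∀ v ∈ W, neutral x u v = 0

variable (m M) in
/-- An almost Dirac structure: a smooth subbundle of the big tangent bundle (a family of subspaces
of the fibres which locally has a smooth frame) whose fibres are maximal `g`-isotropic. -/
structure AlmostDirac where
  fiber : Π x : M, Submodule ℝ (BigTangent m M x)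
  locallyFramed : ∀ x₀ : M, ∃ U : Set M, IsOpen U ∧ x₀ ∈ U ∧
    ∃ (k : ℕ) (e : Fin k → Π x : M, BigTangent m M x),
      (∀ i, SmoothSectionOn U (e i)) ∧
      ∀ x ∈ U, LinearIndependent ℝ (fun i => e i x) ∧
        Submodule.span ℝ (Set.range fun i => e i x) = fiber x
  maximalIsotropic : ∀ x : M, Maximal (IsIsotropic x) (fiber x)

/-- The smooth sections of the almost Dirac structure `E`. -/
def AlmostDirac.IsSection (E : AlmostDirac m M) (s : Π x : M, BigTangent m M x) : Prop :=
  SmoothSection s ∧ ∀ x, s x ∈ E.fiber x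

/-- `E` is integrable if it is closed under the Courant bracket: the bracket of two smooth sections
of `E` takes its values in `E`. -/
def AlmostDirac.Integrable (E : AlmostDirac m M) : Prop :=
  ∀ s t : Π x : M, BigTangent m M x, E.IsSection s → E.IsSection t →
    ∀ x, courant s t x ∈ E.fiber x

/-- The fibre of the `G`-orthogonal complement `E' = E^{⊥_G}`. -/
def AlmostDirac.perp (E : AlmostDirac m M) (G : GenRiemannianMetric m M) (x : M) :
    Submodule ℝ (BigTangent m M x) :=
  (G.form x).orthogonal (E.fiber x)

theorem AlmostDirac.isCompl_perp (E : AlmostDirac m M) (G : GenRiemannianMetric m M) (x : M) :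
    IsCompl (E.fiber x) (E.perp G x) := by
  have : FiniteDimensional ℝ (BigTangent m M x) :=
    inferInstanceAs (FiniteDimensional ℝ (BigModel m))
  have hrefl : (G.form x).IsRefl := by
    intro u v h
    have h1 : neutral x (G.phi x u) v = 0 := h
    have h2 := G.isometry x (G.phi x u) v
    rw [G.phi_phi, h1] at h2
    change neutral x (G.phi x v) u = 0
    rw [← h2]
    simp only [neutral, LinearMap.mk₂_apply]
    ring
  refine (LinearMap.BilinForm.isCompl_orthogonal_iff_disjoint hrefl).2 ?_
  refine Submodule.disjoint_def.2 fun u hu hu' => ?_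
  by_contra hne
  have h1 : neutral x (G.phi x u) u = 0 := hu' u hu
  exact (G.posDef x u hne).ne' h1

/-- The generalized almost paracomplex structure `Ψ_E`: the endomorphism equal to `Id` on `E` and
to `-Id` on `E' = E^{⊥_G}`. -/
def AlmostDirac.para (E : AlmostDirac m M) (G : GenRiemannianMetric m M) (x : M) :
    BigTangent m M x →ₗ[ℝ] BigTangent m M x :=
  (E.fiber x).projection (E.perp G x) (E.isCompl_perp G x)
    - (E.perp G x).projection (E.fiber x) (E.isCompl_perp G x).symm

/-! ### Big connections -/

variable (m M) in
/-- A big connection: a smooth connection `∇` on the big tangent bundle which is compatible with the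
neutral metric `g`. The value of `∇_X s` at `x` is `cov s x (X x)`. -/
structure BigConnection where
  cov : CovariantDerivative (𝓡 m) (BigModel m) (BigTangent m M)
  smooth : CovariantDerivative.ContMDiffCovariantDerivative cov ∞
  metric : ∀ s t : Π x : M, BigTangent m M x, SmoothSection s → SmoothSection t →
    ∀ (x : M) (v : TangentSpace (𝓡 m) x),
      mvfderiv (𝓡 m) (fun y : M => neutral y (s y) (t y)) x v
        = neutral x (cov s x v) (t x) + neutral x (s x) (cov t x v)

/-- `∇` preserves `E` if `∇_X s` is a section of `E` for every section `s` of `E`. -/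
def BigConnection.Preserves (D : BigConnection m M) (E : AlmostDirac m M) : Prop :=
  ∀ s : Π x : M, BigTangent m M x, E.IsSection s →
    ∀ (x : M) (v : TangentSpace (𝓡 m) x), D.cov s x v ∈ E.fiber x

/-- The Courant torsion `T(s, t) = ∇_{pr s} t - ∇_{pr t} s - [s, t]`. -/
def BigConnection.courantTorsion (D : BigConnection m M) (s t : Π x : M, BigTangent m M x)
    (x : M) : BigTangent m M x :=
  D.cov t x (s x).1 - D.cov s x (t x).1 - courant s t x

/-- The Gualtieri torsion
`𝒯(s, t, r) = g(T(s, t), r) + ½ (g(∇_{pr r} s, t) - g(∇_{pr r} t, s))`. -/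
def BigConnection.gualtieriTorsion (D : BigConnection m M) (s t r : Π x : M, BigTangent m M x)
    (x : M) : ℝ :=
  neutral x (D.courantTorsion s t x) (r x)
    + (1 / 2) * (neutral x (D.cov s x (r x).1) (t x) - neutral x (D.cov t x (r x).1) (s x))

/-- The torsion identity
`𝒯(s, t, r) + 𝒯(s, Ψ_E t, r) + 𝒯(Ψ_E s, t, r) + 𝒯(Ψ_E s, Ψ_E t, r) = 0`
for all smooth sections `s`, `t` of the big tangent bundle and all smooth sections `r` of `E`. -/
def BigConnection.TorsionIdentity (D : BigConnection m M) (G : GenRiemannianMetric m M)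
    (E : AlmostDirac m M) : Prop :=
  ∀ s t r : Π x : M, BigTangent m M x, SmoothSection s → SmoothSection t → E.IsSection r →
    ∀ x : M,
      D.gualtieriTorsion s t r x
        + D.gualtieriTorsion s (fun y => E.para G y (t y)) r x
        + D.gualtieriTorsion (fun y => E.para G y (s y)) t r x
        + D.gualtieriTorsion (fun y => E.para G y (s y)) (fun y => E.para G y (t y)) r x = 0

end GeneralizedGeometry

end

/-! The sum in `TorsionIdentity` is, by additivity of the torsion in its first two arguments, the
single term `𝒯(s + Ψs, t + Ψt, r)`, and `s + Ψs` is twice the `E`-component of `s`. On sections of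
`E` the torsion reduces to `-g([s, t], r)`: `∇` preserves `E`, so every `∇`-term pairs two elements
of the isotropic fibre (`gualtieriTorsion_eq`). If `E` is integrable, the bracket lies in `E` too
and the sum vanishes. Conversely, for `s`, `t` in `E` the identity says `4 g([s, t], r) = 0` for all
sections `r` of `E`; these fill the fibres (`exists_section`), and a maximal isotropic fibre is its
own `g`-orthogonal (`mem_of_maximal_of_orthogonal`), so `[s, t]` lies in `E`. The analytic input is
that `Ψ` maps smooth sections to smooth sections (`smoothSection_para`). -/

namespace GeneralizedGeometry

variable {m : ℕ} {M : Type*} [TopologicalSpace M] [ChartedSpace (EuclideanSpace ℝ (Fin m)) M]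
  [IsManifold (𝓡 m) ∞ M]

/-! ### Pointwise smoothness of sections and of their pairings. -/

/-- Smoothness at a point of a section of the big tangent bundle. -/
def SmoothSectionAt (s : Π x : M, BigTangent m M x) (x₀ : M) : Prop :=
  ContMDiffAt (𝓡 m) ((𝓡 m).prod 𝓘(ℝ, BigModel m)) ∞
    (fun x => (⟨x, s x⟩ : BigTangentTotal m M)) x₀

theorem SmoothSectionAt.fst {s : Π x : M, BigTangent m M x} {x₀ : M} (hs : SmoothSectionAt s x₀) :
    ContMDiffAt (𝓡 m) ((𝓡 m).prod 𝓘(ℝ, EuclideanSpace ℝ (Fin m))) ∞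
      (fun x => (⟨x, (s x).1⟩ : TotalSpace (EuclideanSpace ℝ (Fin m))
        (fun x : M => TangentSpace (𝓡 m) x))) x₀ := by
  unfold SmoothSectionAt at hs
  rw [contMDiffAt_section] at hs ⊢
  exact (ContinuousLinearMap.fst ℝ (EuclideanSpace ℝ (Fin m))
    (EuclideanSpace ℝ (Fin m) →L[ℝ] ℝ)).contMDiff.contMDiffAt.comp x₀ hs

theorem SmoothSectionAt.snd {s : Π x : M, BigTangent m M x} {x₀ : M} (hs : SmoothSectionAt s x₀) :
    ContMDiffAt (𝓡 m) ((𝓡 m).prod 𝓘(ℝ, EuclideanSpace ℝ (Fin m) →L[ℝ] ℝ)) ∞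
      (fun x => (⟨x, (s x).2⟩ : TotalSpace (EuclideanSpace ℝ (Fin m) →L[ℝ] ℝ)
        (Cotangent m M))) x₀ := by
  unfold SmoothSectionAt at hs
  rw [contMDiffAt_section] at hs ⊢
  exact (ContinuousLinearMap.snd ℝ (EuclideanSpace ℝ (Fin m))
    (EuclideanSpace ℝ (Fin m) →L[ℝ] ℝ)).contMDiff.contMDiffAt.comp x₀ hs

theorem SmoothSectionAt.pairing {s t : Π x : M, BigTangent m M x} {x₀ : M}
    (hs : SmoothSectionAt s x₀) (ht : SmoothSectionAt t x₀) :
    ContMDiffAt (𝓡 m) 𝓘(ℝ, ℝ) ∞ (fun x => ((s x).2 (t x).1 : ℝ)) x₀ := by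
  have h := ContMDiffAt.clm_bundle_apply (F₁ := EuclideanSpace ℝ (Fin m)) (F₂ := ℝ)
    (E₁ := fun x : M => TangentSpace (𝓡 m) x) (E₂ := Trivial M ℝ) (IM := 𝓡 m)
    (IB := 𝓡 m) (b := fun x : M => x) (n := ∞) hs.snd ht.fst
  rw [contMDiffAt_section] at h
  exact h

theorem SmoothSectionAt.neutral {s t : Π x : M, BigTangent m M x} {x₀ : M}
    (hs : SmoothSectionAt s x₀) (ht : SmoothSectionAt t x₀) :
    ContMDiffAt (𝓡 m) 𝓘(ℝ, ℝ) ∞ (fun x => neutral x (s x) (t x)) x₀ :=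
  (hs.pairing ht).add (ht.pairing hs)

theorem SmoothSectionAt.add {s t : Π x : M, BigTangent m M x} {x₀ : M}
    (hs : SmoothSectionAt s x₀) (ht : SmoothSectionAt t x₀) :
    SmoothSectionAt (fun x => s x + t x) x₀ :=
  ContMDiffAt.add_section hs ht

theorem SmoothSectionAt.sub {s t : Π x : M, BigTangent m M x} {x₀ : M}
    (hs : SmoothSectionAt s x₀) (ht : SmoothSectionAt t x₀) :
    SmoothSectionAt (fun x => s x - t x) x₀ :=
  ContMDiffAt.sub_section hs ht

theorem SmoothSectionAt.mdifferentiableAt {s : Π x : M, BigTangent m M x} {x₀ : M}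
    (hs : SmoothSectionAt s x₀) :
    MDifferentiableAt (𝓡 m) ((𝓡 m).prod 𝓘(ℝ, BigModel m))
      (fun x => (⟨x, s x⟩ : BigTangentTotal m M)) x₀ :=
  ContMDiffAt.mdifferentiableAt hs (by simp)

/-! ### Additivity of the Courant bracket and of the torsion -/

theorem sub_flip_add {V : Type*} [NormedAddCommGroup V] [NormedSpace ℝ V]
    (A B : V →L[ℝ] V →L[ℝ] ℝ) : (A + B) - (A + B).flip = (A - A.flip) + (B - B.flip) := by
  refine ContinuousLinearMap.ext fun u => ContinuousLinearMap.ext fun v => ?_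
  show (A u v + B u v) - (A v u + B v u) = (A u v - A v u) + (B u v - B v u)
  ring

theorem extDer_add {s t : Π x : M, BigTangent m M x} {x₀ : M}
    (hs : SmoothSectionAt s x₀) (ht : SmoothSectionAt t x₀) :
    extDer (fun x => (s x + t x).2) x₀
      = extDer (fun x => (s x).2) x₀ + extDer (fun x => (t x).2) x₀ := by
  have h1 := ((contMDiffAt_hom_bundle _).1 hs.snd).2.mdifferentiableAt (by simp)
  have h2 := ((contMDiffAt_hom_bundle _).1 ht.snd).2.mdifferentiableAt (by simp)
  have h := mvfderiv_add h1 h2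
  unfold extDer
  have e : (fun y : M => ContinuousLinearMap.inCoordinates
      (EuclideanSpace ℝ (Fin m)) (fun y : M => TangentSpace (𝓡 m) y) ℝ (Trivial M ℝ)
      x₀ y x₀ y ((s y + t y).2)) = (fun y : M => ContinuousLinearMap.inCoordinates
      (EuclideanSpace ℝ (Fin m)) (fun y : M => TangentSpace (𝓡 m) y) ℝ (Trivial M ℝ)
      x₀ y x₀ y ((s y).2)) + (fun y : M => ContinuousLinearMap.inCoordinates
      (EuclideanSpace ℝ (Fin m)) (fun y : M => TangentSpace (𝓡 m) y) ℝ (Trivial M ℝ)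
      x₀ y x₀ y ((t y).2)) := by
    funext y
    simp [ContinuousLinearMap.inCoordinates]
  rw [e, h]
  exact sub_flip_add (V := EuclideanSpace ℝ (Fin m)) _ _

theorem lieDerForm_add_left {s s' t : Π x : M, BigTangent m M x} {x₀ : M}
    (hs : SmoothSectionAt s x₀) (hs' : SmoothSectionAt s' x₀) (ht : SmoothSectionAt t x₀) :
    lieDerForm (fun x => (s x + s' x).1) (fun x => (t x).2) x₀
      = lieDerForm (fun x => (s x).1) (fun x => (t x).2) x₀
        + lieDerForm (fun x => (s' x).1) (fun x => (t x).2) x₀ := by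
  have h := mvfderiv_add ((ht.pairing hs).mdifferentiableAt (by simp))
    ((ht.pairing hs').mdifferentiableAt (by simp))
  have e : (fun y : M => ((t y).2 (s y + s' y).1 : ℝ))
      = (fun y : M => ((t y).2 (s y).1 : ℝ)) + fun y : M => ((t y).2 (s' y).1 : ℝ) := by
    funext y
    simp
  unfold lieDerForm
  rw [e, h]
  simp only [Prod.fst_add, map_add]
  abel

theorem lieDerForm_add_right {s t t' : Π x : M, BigTangent m M x} {x₀ : M}
    (hs : SmoothSectionAt s x₀) (ht : SmoothSectionAt t x₀) (ht' : SmoothSectionAt t' x₀) :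
    lieDerForm (fun x => (s x).1) (fun x => (t x + t' x).2) x₀
      = lieDerForm (fun x => (s x).1) (fun x => (t x).2) x₀
        + lieDerForm (fun x => (s x).1) (fun x => (t' x).2) x₀ := by
  have h := mvfderiv_add ((ht.pairing hs).mdifferentiableAt (by simp))
    ((ht'.pairing hs).mdifferentiableAt (by simp))
  have e : (fun y : M => ((t y + t' y).2 (s y).1 : ℝ))
      = (fun y : M => ((t y).2 (s y).1 : ℝ)) + fun y : M => ((t' y).2 (s y).1 : ℝ) := by
    funext y
    simp
  unfold lieDerForm
  rw [e, h, extDer_add ht ht']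
  simp only [_root_.add_apply]
  abel

/-- Reduces additivity on the left to additivity on the right. -/
theorem courant_swap {s t : Π x : M, BigTangent m M x} {x₀ : M}
    (hs : SmoothSectionAt s x₀) (ht : SmoothSectionAt t x₀) :
    courant s t x₀ = - courant t s x₀ := by
  have h1 := (hs.pairing ht).mdifferentiableAt (by simp)
  have h2 := (ht.pairing hs).mdifferentiableAt (by simp)
  have e1 := mvfderiv_sub h1 h2
  have e2 := mvfderiv_sub h2 h1
  unfold courant
  refine Prod.ext ?_ ?_
  · exact VectorField.mlieBracket_swap_apply
  · simp only [Prod.snd_neg]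
    erw [e1, e2]
    module

theorem courant_add_right {s t t' : Π x : M, BigTangent m M x} {x₀ : M}
    (hs : SmoothSectionAt s x₀) (ht : SmoothSectionAt t x₀) (ht' : SmoothSectionAt t' x₀) :
    courant s (fun x => t x + t' x) x₀ = courant s t x₀ + courant s t' x₀ := by
  refine Prod.ext ?_ ?_
  · exact VectorField.mlieBracket_add_right (ht.fst.mdifferentiableAt (by simp))
      (ht'.fst.mdifferentiableAt (by simp))
  · have h := mvfderiv_add
      (((hs.pairing ht).sub (ht.pairing hs)).mdifferentiableAt (by simp))
      (((hs.pairing ht').sub (ht'.pairing hs)).mdifferentiableAt (by simp))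
    have e : (fun y : M => ((s y).2 (t y + t' y).1 - (t y + t' y).2 (s y).1 : ℝ))
        = (fun y : M => ((s y).2 (t y).1 - (t y).2 (s y).1 : ℝ))
          + fun y : M => ((s y).2 (t' y).1 - (t' y).2 (s y).1 : ℝ) := by
      funext y
      simp
      ring
    unfold courant
    rw [Prod.snd_add]
    dsimp only
    rw [e, h, lieDerForm_add_left ht ht' hs, lieDerForm_add_right hs ht ht']
    module

theorem courant_add_left {s s' t : Π x : M, BigTangent m M x} {x₀ : M}
    (hs : SmoothSectionAt s x₀) (hs' : SmoothSectionAt s' x₀) (ht : SmoothSectionAt t x₀) :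
    courant (fun x => s x + s' x) t x₀ = courant s t x₀ + courant s' t x₀ := by
  rw [courant_swap (hs.add hs') ht, courant_add_right ht hs hs', courant_swap hs ht,
    courant_swap hs' ht, neg_add]

theorem BigConnection.cov_add (D : BigConnection m M) {s t : Π x : M, BigTangent m M x} {x₀ : M}
    (hs : SmoothSectionAt s x₀) (ht : SmoothSectionAt t x₀) :
    D.cov (fun x => s x + t x) x₀ = D.cov s x₀ + D.cov t x₀ :=
  D.cov.isCovariantDerivativeOnUniv.add hs.mdifferentiableAt ht.mdifferentiableAt

/-- The torsion depends on `r` only through its value at `x₀`, so `r` needs no smoothness. -/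
theorem BigConnection.gualtieriTorsion_add_left (D : BigConnection m M)
    {s s' t : Π x : M, BigTangent m M x} {x₀ : M} (hs : SmoothSectionAt s x₀)
    (hs' : SmoothSectionAt s' x₀) (ht : SmoothSectionAt t x₀) (r : Π x : M, BigTangent m M x) :
    D.gualtieriTorsion (fun x => s x + s' x) t r x₀
      = D.gualtieriTorsion s t r x₀ + D.gualtieriTorsion s' t r x₀ := by
  unfold gualtieriTorsion courantTorsion
  rw [D.cov_add hs hs', courant_add_left hs hs' ht]
  simp only [Prod.fst_add, map_add, map_sub, _root_.add_apply, LinearMap.add_apply,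
    LinearMap.sub_apply]
  ring

theorem BigConnection.gualtieriTorsion_add_right (D : BigConnection m M)
    {s t t' : Π x : M, BigTangent m M x} {x₀ : M} (hs : SmoothSectionAt s x₀)
    (ht : SmoothSectionAt t x₀) (ht' : SmoothSectionAt t' x₀) (r : Π x : M, BigTangent m M x) :
    D.gualtieriTorsion s (fun x => t x + t' x) r x₀
      = D.gualtieriTorsion s t r x₀ + D.gualtieriTorsion s t' r x₀ := by
  unfold gualtieriTorsion courantTorsion
  rw [D.cov_add ht ht', courant_add_right hs ht ht']
  simp only [Prod.fst_add, map_add, map_sub, _root_.add_apply, LinearMap.add_apply,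
    LinearMap.sub_apply]
  ring

end GeneralizedGeometry

namespace GeneralizedGeometry

variable {m : ℕ} {M : Type*} [TopologicalSpace M] [ChartedSpace (EuclideanSpace ℝ (Fin m)) M]

/-- Feeds Cramer's rule in `smoothSection_para`. -/
theorem contMDiffAt_det {k : ℕ} {A : M → Matrix (Fin k) (Fin k) ℝ} {x₀ : M}
    (hA : ∀ i j, ContMDiffAt (𝓡 m) 𝓘(ℝ, ℝ) ∞ (fun x => A x i j) x₀) :
    ContMDiffAt (𝓡 m) 𝓘(ℝ, ℝ) ∞ (fun x => (A x).det) x₀ := by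
  simp only [Matrix.det_apply']
  exact contMDiffAt_finsetSum fun σ _ =>
    contMDiffAt_const.mul (contMDiffAt_finsetProd fun i _ => hA _ _)

/-! ### Maximal isotropic subspaces are their own orthogonal complements -/

theorem neutral_comm (x : M) (u v : BigTangent m M x) : neutral x u v = neutral x v u :=
  add_comm _ _

/-- The inclusion of the tangent space in the big tangent space as the graph of `c` times the
standard inner product. -/
noncomputable def graphMap (c : ℝ) (x : M) : EuclideanSpace ℝ (Fin m) →ₗ[ℝ] BigTangent m M x where
  toFun v := (v, c • innerSL ℝ v)
  map_add' u v := Prod.ext rfl (by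
    show c • innerSL ℝ (u + v) = c • innerSL ℝ u + c • innerSL ℝ v
    rw [map_add, smul_add])
  map_smul' a v := Prod.ext rfl (by
    show c • innerSL ℝ (a • v) = a • c • innerSL ℝ v
    rw [map_smul, smul_comm])

/-- For `c = 1` and `c = -1` the graphs are `g`-orthogonal to each other, and `g` is positive
definite on one and negative definite on the other: `g` has signature `(m, m)`. -/
theorem neutral_graphMap (c d : ℝ) (x : M) (u v : EuclideanSpace ℝ (Fin m)) :
    neutral x (graphMap c x u) (graphMap d x v) = (c + d) * inner ℝ u v := by
  show c * inner ℝ u v + d * inner ℝ v u = _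
  rw [real_inner_comm u v]
  ring

theorem neutral_nondegenerate (x : M) : (neutral (m := m) x).Nondegenerate := by
  have key : ∀ u : BigTangent m M x, (∀ v, neutral x u v = 0) → u = 0 := by
    intro u hu
    have h1 : u.1 = 0 := by
      have h := hu (0, innerSL ℝ (show EuclideanSpace ℝ (Fin m) from u.1))
      have h' : u.2 0 + inner ℝ (show EuclideanSpace ℝ (Fin m) from u.1)
        (show EuclideanSpace ℝ (Fin m) from u.1) = (0 : ℝ) := h
      rw [map_zero, zero_add] at h'
      exact inner_self_eq_zero.1 h'
    refine Prod.ext h1 (ContinuousLinearMap.ext fun v => ?_)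
    have h : (u.2 v + (0 : TangentSpace (𝓡 m) x →L[ℝ] ℝ) u.1 : ℝ) = 0 := hu (v, 0)
    simpa using h
  exact ⟨key, fun u hu => key u fun v => by rw [neutral_comm]; exact hu v⟩

/-- `W + ℝu` is still isotropic, so maximality absorbs `u`. -/
theorem mem_of_maximal_of_orthogonal_of_isotropic {x : M} {W : Submodule ℝ (BigTangent m M x)}
    (hW : Maximal (IsIsotropic x) W) {u : BigTangent m M x} (hu : ∀ w ∈ W, neutral x u w = 0)
    (huu : neutral x u u = 0) : u ∈ W := by
  have hiso : IsIsotropic x (W ⊔ Submodule.span ℝ {u}) := by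
    intro a ha b hb
    obtain ⟨w, hw, p, hp, rfl⟩ := Submodule.mem_sup.1 ha
    obtain ⟨w', hw', p', hp', rfl⟩ := Submodule.mem_sup.1 hb
    obtain ⟨c, rfl⟩ := Submodule.mem_span_singleton.1 hp
    obtain ⟨c', rfl⟩ := Submodule.mem_span_singleton.1 hp'
    simp only [map_add, map_smul, LinearMap.add_apply, LinearMap.smul_apply, huu, hu w' hw',
      neutral_comm x w u, hu w hw, hW.prop w hw w' hw', smul_zero, add_zero]
  exact hW.le_of_ge hiso le_sup_left
    (Submodule.mem_sup_right (Submodule.mem_span_singleton_self u))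

theorem exists_ne_zero_forall_mem_eq_zero {K F V : Type*} [Field K] [AddCommGroup F] [Module K F]
    [FiniteDimensional K F] [AddCommGroup V] [Module K V] [FiniteDimensional K V]
    (B : F →ₗ[K] V →ₗ[K] K) (W : Submodule K V)
    (hW : Module.finrank K W < Module.finrank K F) : ∃ v, v ≠ 0 ∧ ∀ w ∈ W, B v w = 0 := by
  have hf : LinearMap.ker (W.subtype.dualMap ∘ₗ B : F →ₗ[K] Module.Dual K W) ≠ ⊥ :=
    LinearMap.ker_ne_bot_of_finrank_lt (Subspace.dual_finrank_eq.trans_lt hW)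
  obtain ⟨v, hv, hv0⟩ := Submodule.exists_mem_ne_zero_of_ne_bot hf
  exact ⟨v, hv0, fun w hw => LinearMap.congr_fun hv ⟨w, hw⟩⟩

theorem exists_graphMap_orthogonal (c : ℝ) {x : M} {W : Submodule ℝ (BigTangent m M x)}
    (hW : Module.finrank ℝ W < m) :
    ∃ v : EuclideanSpace ℝ (Fin m), v ≠ 0 ∧ ∀ w ∈ W, neutral x (graphMap c x v) w = 0 := by
  have : FiniteDimensional ℝ (BigTangent m M x) :=
    inferInstanceAs (FiniteDimensional ℝ (BigModel m))
  exact exists_ne_zero_forall_mem_eq_zero (neutral x ∘ₗ graphMap c x) W (by simpa using hW)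

/-- If `dim W < m`, each of the two definite graphs contains a nonzero vector orthogonal to `W`.
Scaled to opposite squares, their sum and difference are null and orthogonal to `W`, hence in `W`;
but they pair to something nonzero. -/
theorem le_finrank_of_maximal {x : M} {W : Submodule ℝ (BigTangent m M x)}
    (hW : Maximal (IsIsotropic x) W) : m ≤ Module.finrank ℝ W := by
  by_contra! hlt
  obtain ⟨p, hp, hpW⟩ := exists_graphMap_orthogonal 1 hlt
  obtain ⟨n, hn, hnW⟩ := exists_graphMap_orthogonal (-1) hlt
  -- The crossed factors `‖n‖` and `‖p‖` give the two summands the squares `±2‖p‖²‖n‖²`, which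
  -- cancel for `ε = ±1`.
  have key : ∀ ε : ℝ, ε ^ 2 = 1 → graphMap 1 x (‖n‖ • p) + ε • graphMap (-1) x (‖p‖ • n) ∈ W := by
    intro ε hε
    refine mem_of_maximal_of_orthogonal_of_isotropic hW (fun w hw => ?_) ?_
    · simp [hpW w hw, hnW w hw]
    · simp only [map_add, map_smul, LinearMap.add_apply, LinearMap.smul_apply, neutral_graphMap,
        real_inner_self_eq_norm_sq, smul_eq_mul]
      linear_combination -2 * ‖p‖ ^ 2 * ‖n‖ ^ 2 * hε
  have h := hW.prop _ (key 1 (by norm_num)) _ (key (-1) (by norm_num))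
  simp only [map_add, map_smul, LinearMap.add_apply, LinearMap.smul_apply, neutral_graphMap,
    real_inner_self_eq_norm_sq, smul_eq_mul] at h
  have h0 : ‖n‖ ^ 2 * ‖p‖ ^ 2 = 0 := by linear_combination h / 4
  simp_all

/-- Isotropy gives `W ≤ W^⊥`, and `dim W^⊥ = 2m - dim W ≤ m ≤ dim W` forces equality. -/
theorem mem_of_maximal_of_orthogonal {x : M} {W : Submodule ℝ (BigTangent m M x)}
    (hW : Maximal (IsIsotropic x) W) {u : BigTangent m M x}
    (hu : ∀ w ∈ W, neutral x u w = 0) : u ∈ W := by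
  have : FiniteDimensional ℝ (BigTangent m M x) :=
    inferInstanceAs (FiniteDimensional ℝ (BigModel m))
  have hdim : Module.finrank ℝ (BigTangent m M x) = m + m := by
    have : Module.finrank ℝ (EuclideanSpace ℝ (Fin m) →L[ℝ] ℝ) = m := by
      rw [← (LinearMap.toContinuousLinearMap (𝕜 := ℝ) (E := EuclideanSpace ℝ (Fin m))
        (F' := ℝ)).finrank_eq]
      exact Subspace.dual_finrank_eq.trans (by simp)
    show Module.finrank ℝ (BigModel m) = m + m
    rw [Module.finrank_prod, this]
    simp
  have horth := LinearMap.BilinForm.finrank_orthogonal (neutral_nondegenerate x) W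
  have hle : W ≤ (neutral x).orthogonal W := fun w hw w' hw' => hW.prop w' hw' w hw
  have heq : W = (neutral x).orthogonal W := by
    apply Submodule.eq_of_le_of_finrank_le hle
    have := le_finrank_of_maximal hW
    omega
  rw [heq]
  exact fun w hw => by
    show neutral x w u = 0
    rw [neutral_comm, hu w hw]

/-! ### Extension of vectors to sections -/

variable [IsManifold (𝓡 m) ∞ M]

theorem SmoothSection.smoothSectionAt {s : Π x : M, BigTangent m M x} (hs : SmoothSection s)
    (x : M) : SmoothSectionAt s x :=
  ContMDiff.contMDiffAt hs

/-- A constant-coefficient combination of a local frame, cut off by a bump function supported in the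
frame's domain. -/
theorem AlmostDirac.exists_section [T2Space M] (E : AlmostDirac m M) {x₀ : M}
    {u : BigTangent m M x₀} (hu : u ∈ E.fiber x₀) : ∃ r, E.IsSection r ∧ r x₀ = u := by
  obtain ⟨U, hU, hx₀, k, e, he, hspan⟩ := E.locallyFramed x₀
  rw [← (hspan x₀ hx₀).2] at hu
  obtain ⟨c, rfl⟩ := (Submodule.mem_span_range_iff_exists_fun ℝ).1 hu
  obtain ⟨f, -, hf⟩ := (SmoothBumpFunction.nhds_basis_tsupport (I := 𝓡 m) x₀).mem_iff.1
    (hU.mem_nhds hx₀)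
  have hsec : SmoothSectionOn U (fun x => ∑ i, c i • e i x) :=
    ContMDiffOn.sum_section fun i _ => (he i).const_smul_section
  refine ⟨fun x => f x • ∑ i, c i • e i x, ⟨?_, fun x => ?_⟩, ?_⟩
  · exact ContMDiffOn.smul_section_of_tsupport f.contMDiff.contMDiffOn hU hf hsec
  · by_cases hx : x ∈ U
    · rw [← (hspan x hx).2]
      exact Submodule.smul_mem _ _ (Submodule.sum_mem _ fun i _ =>
        Submodule.smul_mem _ _ (Submodule.subset_span ⟨i, rfl⟩))
    · have : f x = 0 := image_eq_zero_of_notMem_tsupport fun h => hx (hf h)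
      simp only [this, zero_smul, zero_mem]
  · simp only [f.eq_one, one_smul]

/-! ### Smoothness of the paracomplex structure -/

theorem GenRiemannianMetric.smoothSectionAt_phi (G : GenRiemannianMetric m M)
    {s : Π x : M, BigTangent m M x} {x₀ : M} (hs : SmoothSectionAt s x₀) :
    SmoothSectionAt (fun x => G.phi x (s x)) x₀ := by
  unfold SmoothSectionAt at hs ⊢
  exact (G.smooth ⟨x₀, s x₀⟩).comp x₀ hs

theorem AlmostDirac.para_apply_of_eq_add (E : AlmostDirac m M) (G : GenRiemannianMetric m M)
    {x : M} {u p q : BigTangent m M x} (hp : p ∈ E.fiber x) (hq : q ∈ E.perp G x)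
    (h : u = p + q) : E.para G x u = p - q := by
  rw [h, para, LinearMap.sub_apply, map_add, map_add, Submodule.projection_apply_of_mem_left _ hp,
    Submodule.projection_apply_of_mem_right _ hq, Submodule.projection_apply_of_mem_left _ hq,
    Submodule.projection_apply_of_mem_right _ hp, add_zero, zero_add]

theorem AlmostDirac.para_of_mem (E : AlmostDirac m M) (G : GenRiemannianMetric m M)
    {x : M} {u : BigTangent m M x} (hu : u ∈ E.fiber x) : E.para G x u = u := by
  rw [E.para_apply_of_eq_add G hu (zero_mem _) (add_zero u).symm, sub_zero]

/-- The vector is twice the `E`-component of `u`. -/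
theorem AlmostDirac.add_para_mem (E : AlmostDirac m M) (G : GenRiemannianMetric m M)
    {x : M} (u : BigTangent m M x) : u + E.para G x u ∈ E.fiber x := by
  obtain ⟨p, hp, q, hq, rfl⟩ := Submodule.mem_sup.1
    ((E.isCompl_perp G x).sup_eq_top ▸ Submodule.mem_top (x := u))
  rw [E.para_apply_of_eq_add G hp hq rfl, add_add_sub_cancel]
  exact add_mem hp hp

/-- In a local frame, the coefficients of the `G`-orthogonal projection to `E` solve a linear system
whose matrix is the Gram matrix of the frame. Cramer's rule makes them smooth. -/
theorem AlmostDirac.smoothSection_para (E : AlmostDirac m M) (G : GenRiemannianMetric m M)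
    {s : Π x : M, BigTangent m M x} (hs : SmoothSection s) :
    SmoothSection fun x => E.para G x (s x) := by
  intro x₀
  obtain ⟨U, hU, hx₀, k, e, he, hspan⟩ := E.locallyFramed x₀
  have hs₀ := hs.smoothSectionAt x₀
  have he₀ : ∀ i, SmoothSectionAt (e i) x₀ := fun i => (he i).contMDiffAt (hU.mem_nhds hx₀)
  let A : M → Matrix (Fin k) (Fin k) ℝ := fun x i j => neutral x (G.phi x (e i x)) (e j x)
  let b : M → Fin k → ℝ := fun x i => neutral x (G.phi x (e i x)) (s x)
  let c : Fin k → M → ℝ := fun i x => (A x).det⁻¹ * ((A x).updateCol i (b x)).det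
  let p : Π x : M, BigTangent m M x := fun x => ∑ i, c i x • e i x
  -- A kernel vector `v` of the Gram matrix would give `u = ∑ vᵢ eᵢ` with `G(u, u) = 0`, so `u = 0`,
  -- contradicting independence of the frame.
  have hdet : ∀ x ∈ U, (A x).det ≠ 0 := by
    intro x hx hzero
    obtain ⟨v, hv0, hv⟩ := Matrix.exists_mulVec_eq_zero_iff.2 hzero
    refine hv0 (funext fun i => Fintype.linearIndependent_iff.1 (hspan x hx).1 v ?_ i)
    by_contra hne
    refine (G.posDef x _ hne).ne' ?_
    rw [map_sum (G.phi x), map_sum (neutral x), LinearMap.sum_apply]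
    refine Finset.sum_eq_zero fun i _ => ?_
    have hi : ∑ j, A x i j * v j = 0 := congrFun hv i
    simp only [map_smul, map_sum, LinearMap.smul_apply, smul_eq_mul]
    calc ∑ j, v j * (v i * neutral x (G.phi x (e i x)) (e j x))
        = v i * ∑ j, A x i j * v j := by
          rw [Finset.mul_sum]
          exact Finset.sum_congr rfl fun j _ => by ring
      _ = 0 := by rw [hi, mul_zero]
  have hA : ∀ i j, ContMDiffAt (𝓡 m) 𝓘(ℝ, ℝ) ∞ (fun x => A x i j) x₀ := fun i j =>
    (G.smoothSectionAt_phi (he₀ i)).neutral (he₀ j)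
  have hb : ∀ i, ContMDiffAt (𝓡 m) 𝓘(ℝ, ℝ) ∞ (fun x => b x i) x₀ := fun i =>
    (G.smoothSectionAt_phi (he₀ i)).neutral hs₀
  have hc : ∀ i, ContMDiffAt (𝓡 m) 𝓘(ℝ, ℝ) ∞ (c i) x₀ := by
    intro i
    refine ((contMDiffAt_det hA).inv₀ (hdet x₀ hx₀)).mul (contMDiffAt_det fun j l => ?_)
    by_cases h : l = i
    · subst h
      simpa only [Matrix.updateCol_self] using hb j
    · simpa only [Matrix.updateCol_ne h] using hA j l
  have hp : SmoothSectionAt p x₀ :=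
    ContMDiffAt.sum_section fun i _ => (hc i).smul_section (he₀ i)
  have hmem : ∀ x ∈ U, p x ∈ E.fiber x := fun x hx => by
    rw [← (hspan x hx).2]
    exact Submodule.sum_mem _ fun i _ => Submodule.smul_mem _ _ (Submodule.subset_span ⟨i, rfl⟩)
  have hAc : ∀ x ∈ U, ∀ i, ∑ j, A x i j * c j x = b x i := by
    intro x hx i
    have h : ∑ j, A x i j * ((A x).updateCol j (b x)).det = (A x).det * b x i := by
      simpa [Matrix.mulVec, dotProduct, Matrix.cramer_apply] using
        congrFun (Matrix.mulVec_cramer (A x) (b x)) i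
    calc ∑ j, A x i j * c j x
        = (A x).det⁻¹ * ∑ j, A x i j * ((A x).updateCol j (b x)).det := by
          rw [Finset.mul_sum]
          exact Finset.sum_congr rfl fun j _ => mul_left_comm _ _ _
      _ = b x i := by rw [h, inv_mul_cancel_left₀ (hdet x hx)]
  -- Tested on the frame, orthogonality is exactly the system `hAc`.
  have hperp : ∀ x ∈ U, s x - p x ∈ E.perp G x := by
    intro x hx u hu
    show neutral x (G.phi x u) (s x - p x) = 0
    rw [← (hspan x hx).2] at hu
    induction hu using Submodule.span_induction with
    | mem u hu =>
      obtain ⟨i, rfl⟩ := hu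
      rw [map_sub, map_sum, sub_eq_zero]
      change b x i = _
      rw [← hAc x hx i]
      refine Finset.sum_congr rfl fun j _ => ?_
      rw [map_smul, smul_eq_mul, mul_comm]
    | zero => simp
    | add u v _ _ hu hv => rw [map_add, map_add, LinearMap.add_apply, hu, hv, add_zero]
    | smul a u _ hu => rw [map_smul, map_smul, LinearMap.smul_apply, hu, smul_zero]
  have hsmooth : SmoothSectionAt (fun x => p x - (s x - p x)) x₀ := hp.sub (hs₀.sub hp)
  refine ContMDiffAt.congr_of_eventuallyEq hsmooth ?_
  filter_upwards [hU.mem_nhds hx₀] with x hx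
  rw [E.para_apply_of_eq_add G (hmem x hx) (hperp x hx) (add_sub_cancel _ _).symm]

/-! ### The torsion on an almost Dirac structure -/

theorem BigConnection.Preserves.gualtieriTorsion_eq {D : BigConnection m M} {E : AlmostDirac m M}
    (hD : D.Preserves E) {s t r : Π x : M, BigTangent m M x} (hs : E.IsSection s)
    (ht : E.IsSection t) (hr : E.IsSection r) (x : M) :
    D.gualtieriTorsion s t r x = -neutral x (courant s t x) (r x) := by
  have hE := (E.maximalIsotropic x).prop
  unfold gualtieriTorsion courantTorsion
  rw [hE _ (hD s hs x _) _ (ht.2 x), hE _ (hD t ht x _) _ (hs.2 x), map_sub, map_sub,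
    LinearMap.sub_apply, LinearMap.sub_apply, hE _ (hD t ht x _) _ (hr.2 x),
    hE _ (hD s hs x _) _ (hr.2 x)]
  ring

theorem AlmostDirac.isSection_add_para (E : AlmostDirac m M) (G : GenRiemannianMetric m M)
    {s : Π x : M, BigTangent m M x} (hs : SmoothSection s) :
    E.IsSection fun x => s x + E.para G x (s x) :=
  ⟨fun x => (hs.smoothSectionAt x).add ((E.smoothSection_para G hs).smoothSectionAt x),
    fun _ => E.add_para_mem G _⟩

end GeneralizedGeometry

/-! ### The two implications. -/

open GeneralizedGeometry in
theorem proposition3p4 {m : ℕ} {M : Type*} [TopologicalSpace M]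
    [ChartedSpace (EuclideanSpace ℝ (Fin m)) M] [IsManifold (𝓡 m) ∞ M]
    [T2Space M] [SecondCountableTopology M]
    (G : GenRiemannianMetric m M) (E : AlmostDirac m M) :
    ((∃ D : BigConnection m M, D.Preserves E ∧ D.TorsionIdentity G E) → E.Integrable) ∧
      (E.Integrable → ∀ D : BigConnection m M, D.Preserves E → D.TorsionIdentity G E) := by
  constructor
  · rintro ⟨D, hD, hT⟩ s t hs ht x
    refine mem_of_maximal_of_orthogonal (E.maximalIsotropic x) fun w hw => ?_
    obtain ⟨r, hr, rfl⟩ := E.exists_section hw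
    have h := hT s t r hs.1 ht.1 hr x
    -- `Ψ` fixes `s` and `t`, so the four terms coincide.
    simp only [E.para_of_mem G (hs.2 _), E.para_of_mem G (ht.2 _),
      hD.gualtieriTorsion_eq hs ht hr] at h
    linarith
  · intro hE D hD s t r hs ht hr x
    have hs' := (E.smoothSection_para G hs).smoothSectionAt x
    have ht' := (E.smoothSection_para G ht).smoothSectionAt x
    have hs₀ := hs.smoothSectionAt x
    have ht₀ := ht.smoothSectionAt x
    -- The torsion of the two `E`-valued sections vanishes; expanding it by additivity gives the
    -- four terms.
    have h := hD.gualtieriTorsion_eq (E.isSection_add_para G hs) (E.isSection_add_para G ht) hr x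
    rw [(E.maximalIsotropic x).prop _ (hE _ _ (E.isSection_add_para G hs)
      (E.isSection_add_para G ht) x) _ (hr.2 x), neg_zero,
      D.gualtieriTorsion_add_left hs₀ hs' (ht₀.add ht'),
      D.gualtieriTorsion_add_right hs₀ ht₀ ht', D.gualtieriTorsion_add_right hs' ht₀ ht'] at h
    linarith
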